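/- Let $R$ be a real closed field, let $k$ be an algebraically closed field identified with $R+\sqrt{-1}\,R$, and let $K\subseteq k$ be a set of parameters. Definable sets of $k$ and of $R$ are those of the first-order language of rings. Let $X_\bullet=(X_0,X_1;s,t,c,i,e)$ be a groupoid definable in $k$ over $K$: the sets of objects $X_0\subseteq k^{n_0}$ and of arrows $X_1\subseteq k^{n_1}$ and the graphs of the structure maps (source $s$, target $t$, composition $c$, inverse $i$, identity $e$) are definable in $k$ over $K$. Suppose that $X_\bullet$ is bounded by an Abelian group $A$ definable in $k$ over $K$, i.e. for every $x\in X_0$ there is a group isomorphism $\operatorname{Mor}(x,x)\cong A$ which is definable in $k$ over some parameter set $L\supseteq K$. Identify $k^n$ with $R^{2n}$ by real and imaginary parts, and regard $K$ as a set of parameters in $R$ by replacing its elements by their real and imaginary parts. Then $X_\bullet$, so regarded, is a groupoid definable in $R$ over $K$, and it is eliminable in $R$ over the same $K$: the groupoid quotient $[X_\bullet]$, i.e. $X_0$ modulo the relation "there is an arrow from $x$ to $y$", is represented by a set definable in $R$ over $K$ with a quotient map $\pi:X_0\to[X_\bullet]$ definable in $R$ over $K$, and there is an $X_\bullet$-torsor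 over $[X_\bullet]$ definable in $R$ over $K$. The latter means a set $P$, a surjection $p:P\to[X_\bullet]$, an anchor map $a:P\to X_0$ with $\pi\circ a=p$, and an action assigning to $m\in X_1$ and $q\in P$ with $s(m)=a(q)$ an element $m\cdot q\in P$, all definable in $R$ over $K$, such that $a(m\cdot q)=t(m)$, $p(m\cdot q)=p(q)$, identities act trivially, the action is compatible with composition, and for any $q,q'\in P$ with $p(q)=p(q')$ there is a unique $m\in X_1$ with $s(m)=a(q)$ and $m\cdot q=q'$. -/

import Mathlib

namespace ElimGroupoid

open FirstOrder

universe u v w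

/-! ### Definability in a ring -/

section Definability

variable {F : Type u} [CommRing F]

/-- `S ⊆ F ^ ι` is definable over the parameter set `K` in the ring `F`, that is, by a first-order
formula of the language of rings with parameters from `K`. -/
def IsDefinable (K : Set F) {ι : Type*} (S : Set (ι → F)) : Prop :=
  letI : Ring.CompatibleRing F := Ring.compatibleRingOfRing F
  K.Definable Language.ring S

/-- The map `f : X → Y` between `X ⊆ F ^ ι` and `Y ⊆ F ^ κ` has a graph definable over `K`. -/
def IsDefinableMap (K : Set F) {ι κ : Type*} {X : Set (ι → F)} {Y : Set (κ → F)}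
    (f : X → Y) : Prop :=
  IsDefinable K (Set.range fun x : X => (Sum.elim x.1 (f x).1 : ι ⊕ κ → F))

/-- The group structure on `A ⊆ F ^ ι` makes it a group definable over `K`: the set and the graph
of the multiplication are definable over `K`. -/
def IsDefinableGroup (K : Set F) {ι : Type*} (A : Set (ι → F)) [Group A] : Prop :=
  IsDefinable K A ∧
  IsDefinable K (Set.range fun p : A × A =>
    (Sum.elim p.1.1 (Sum.elim p.2.1 (p.1 * p.2).1) : ι ⊕ (ι ⊕ ι) → F))

end Definability

/-! ### Groupoids and their torsors -/

/-- A small groupoid given by its structure maps, with objects `O` and arrows `M`.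
`comp g f _` is the arrow "first `f`, then `g`". -/
structure Gpd (O : Type u) (M : Type v) where
  src : M → O
  tgt : M → O
  comp : (g f : M) → src g = tgt f → M
  inv : M → M
  one : O → M
  src_comp : ∀ g f h, src (comp g f h) = src f
  tgt_comp : ∀ g f h, tgt (comp g f h) = tgt g
  src_one : ∀ x, src (one x) = x
  tgt_one : ∀ x, tgt (one x) = x
  src_inv : ∀ f, src (inv f) = tgt f
  tgt_inv : ∀ f, tgt (inv f) = src f
  comp_one : ∀ f, comp f (one (src f)) (tgt_one _).symm = f
  one_comp : ∀ f, comp (one (tgt f)) f (src_one _) = f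
  inv_comp : ∀ f, comp (inv f) f (src_inv f) = one (src f)
  comp_inv : ∀ f, comp f (inv f) (tgt_inv f).symm = one (tgt f)
  assoc : ∀ f₃ f₂ f₁ h₃₂ h₂₁,
    comp (comp f₃ f₂ h₃₂) f₁ ((src_comp _ _ _).trans h₂₁) =
      comp f₃ (comp f₂ f₁ h₂₁) (h₃₂.trans (tgt_comp _ _ _).symm)

namespace Gpd

/-- The set `Mor(x, y)` of arrows from `x` to `y`. -/
def Mor {O : Type u} {M : Type v} (X : Gpd O M) (x y : O) : Type v :=
  {f : M // X.src f = x ∧ X.tgt f = y}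

/-- Composition `Mor(x, x) × Mor(x, x) → Mor(x, x)`. -/
def loopComp {O : Type u} {M : Type v} (X : Gpd O M) {x : O} (g f : X.Mor x x) : X.Mor x x :=
  ⟨X.comp g.1 f.1 (g.2.1.trans f.2.2.symm),
    (X.src_comp _ _ _).trans f.2.1, (X.tgt_comp _ _ _).trans g.2.2⟩

/-- The same groupoid after renaming objects and arrows along bijections. -/
def transport {O : Type u} {M : Type v} {O' : Type*} {M' : Type*} (X : Gpd O M)
    (a : O ≃ O') (b : M ≃ M') : Gpd O' M' where
  src f := a (X.src (b.symm f))
  tgt f := a (X.tgt (b.symm f))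
  comp g f h := b (X.comp (b.symm g) (b.symm f) (a.injective h))
  inv f := b (X.inv (b.symm f))
  one x := b (X.one (a.symm x))
  src_comp g f h := by simp [X.src_comp]
  tgt_comp g f h := by simp [X.tgt_comp]
  src_one x := by simp [X.src_one]
  tgt_one x := by simp [X.tgt_one]
  src_inv f := by simp [X.src_inv]
  tgt_inv f := by simp [X.tgt_inv]
  comp_one f := by simp [X.comp_one]
  one_comp f := by simp [X.one_comp]
  inv_comp f := by simp [X.inv_comp]
  comp_inv f := by simp [X.comp_inv]
  assoc f₃ f₂ f₁ h₃₂ h₂₁ := by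
    simpa using X.assoc _ _ _ (a.injective h₃₂) (a.injective h₂₁)

/-- A torsor (principal homogeneous space) `P → Y` of a groupoid `X` over `Y`, with anchor map
`P → O` and left action `(m, q) ↦ m · q`, defined when the source of `m` is the anchor of `q`.
The projection is onto, and any two points of a fibre differ by a unique arrow. -/
structure Torsor {O : Type u} {M : Type v} (X : Gpd O M) (P : Type*) (Y : Type*) where
  proj : P → Y
  anchor : P → O
  act : (m : M) → (q : P) → X.src m = anchor q → P
  proj_act : ∀ m q h, proj (act m q h) = proj q
  anchor_act : ∀ m q h, anchor (act m q h) = X.tgt m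
  one_act : ∀ q, act (X.one (anchor q)) q (X.src_one _) = q
  comp_act : ∀ n m q (hnm : X.src n = X.tgt m) (hmq : X.src m = anchor q),
    act (X.comp n m hnm) q ((X.src_comp _ _ _).trans hmq) =
      act n (act m q hmq) (hnm.trans (anchor_act _ _ _).symm)
  proj_surjective : Function.Surjective proj
  existsUnique_act : ∀ q q', proj q = proj q' → ∃! m : M, ∃ h : X.src m = anchor q, act m q h = q'

/-- `π : O → Y` presents `Y` as the groupoid quotient `[X]`, the set of objects modulo the relation
"there is an arrow from `x` to `y`". -/
def IsQuotientMap {O : Type u} {M : Type v} (X : Gpd O M) {Y : Type*} (π : O → Y) : Prop :=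
  Function.Surjective π ∧ ∀ x y, π x = π y ↔ Nonempty (X.Mor x y)

/-! ### Definable groupoids -/

section Definable

variable {F : Type u} [CommRing F] {ι κ : Type*} {X₀ : Set (ι → F)} {X₁ : Set (κ → F)}

/-- `X` is a definable groupoid over `K`: its sets of objects and arrows and (the graphs of) all
its structure maps are definable over `K`. -/
structure DefinableOver (X : Gpd X₀ X₁) (K : Set F) : Prop where
  obj : IsDefinable K X₀
  arrow : IsDefinable K X₁
  src : IsDefinableMap K X.src
  tgt : IsDefinableMap K X.tgt
  inv : IsDefinableMap K X.inv
  one : IsDefinableMap K X.one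
  comp : IsDefinable K (Set.range fun p : {p : X₁ × X₁ // X.src p.1 = X.tgt p.2} =>
    (Sum.elim p.1.1.1 (Sum.elim p.1.2.1 (X.comp p.1.1 p.1.2 p.2).1) : κ ⊕ (κ ⊕ κ) → F))

/-- `X` is bounded by the group `A`: every `Mor(x, x)` is isomorphic to `A`, by an isomorphism
definable over some set of parameters `L` that contains `K` and may depend on `x`. -/
def BoundedBy (X : Gpd X₀ X₁) (K : Set F) {μ : Type*} (A : Set (μ → F)) [Group A] : Prop :=
  ∀ x : X₀, ∃ φ : X.Mor x x ≃ A, (∀ g f, φ (X.loopComp g f) = φ g * φ f) ∧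
    ∃ L : Set F, K ⊆ L ∧
      IsDefinable L (Set.range fun f : X.Mor x x => (Sum.elim f.1.1 (φ f).1 : κ ⊕ μ → F))

/-- `X` is eliminable over `K`: the groupoid quotient is presented by a set `Y` and a map
`π : X₀ → Y` definable over `K`, and there is an `X`-torsor `P` over this quotient such that `P`,
its projection, its anchor map and its action are definable over `K`. The fibre of `P` over a
connected component of `X` is anchored in that component. -/
def EliminableOver (X : Gpd X₀ X₁) (K : Set F) : Prop :=
  ∃ (l m : ℕ) (Y : Set (Fin l → F)) (π : X₀ → Y) (P : Set (Fin m → F)) (T : X.Torsor P Y),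
    IsDefinable K Y ∧ IsDefinableMap K π ∧ X.IsQuotientMap π ∧
    IsDefinable K P ∧ IsDefinableMap K T.proj ∧ IsDefinableMap K T.anchor ∧
    IsDefinable K (Set.range fun p : {p : X₁ × P // X.src p.1 = T.anchor p.2} =>
      (Sum.elim p.1.1.1 (Sum.elim p.1.2.1 (T.act p.1.1 p.1.2 p.2).1) : κ ⊕ (Fin m ⊕ Fin m) → F)) ∧
    ∀ q : P, T.proj q = π (T.anchor q)

end Definable

end Gpd

/-! ### From `k = R + √-1 R` to `R` -/

section Real

variable {R : Type u} {k : Type v} [Field R] [Field k]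

/-- The ring `R + √-1 R`: pairs `re + im ω` with `ω ^ 2 = -1`. -/
abbrev Cplx (R : Type u) [Field R] : Type u := QuadraticAlgebra R (-1) 0

/-- Given an identification of `k` with `R + √-1 R`, the identification of `k ^ ι` with
`R ^ (ι ⊕ ι)` by real and imaginary parts. -/
def realCoords (e : k ≃+* Cplx R) (ι : Type w) : (ι → k) ≃ (ι ⊕ ι → R) where
  toFun z := Sum.elim (fun j => (e (z j)).re) (fun j => (e (z j)).im)
  invFun r j := e.symm ⟨r (Sum.inl j), r (Sum.inr j)⟩
  left_inv z := by ext j; simp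
  right_inv r := by ext j; cases j <;> simp

/-- A set of parameters of `k`, seen in `R`: the real and imaginary parts of its elements. -/
def realParams (e : k ≃+* Cplx R) (K : Set k) : Set R :=
  (fun z => (e z).re) '' K ∪ (fun z => (e z).im) '' K

/-- The groupoid `X` in `k`, seen as a groupoid in `R`. -/
def Gpd.toReal (e : k ≃+* Cplx R) {ι κ : Type*} {X₀ : Set (ι → k)} {X₁ : Set (κ → k)}
    (X : Gpd X₀ X₁) : Gpd (realCoords e ι '' X₀ : Set (ι ⊕ ι → R))
      (realCoords e κ '' X₁ : Set (κ ⊕ κ → R)) :=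
  X.transport ((realCoords e ι).image X₀) ((realCoords e κ).image X₁)

end Real

end ElimGroupoid

open ElimGroupoid

/-! The theorem reduces to choosing, definably in `R` over the given parameters, one object in each
isomorphism class. Let `ρ` send an object to the chosen object of its class. Then the fixed points
of `ρ` represent the quotient, with `ρ` as quotient map, and the arrows that start at a fixed point
form a torsor under left composition (`representativeTorsor`, `DefinableOver.eliminableOver`).

The choice combines two facts. An algebraically closed field is minimal: a definable subset of the
line `k` is finite or cofinite (`IsDefinable.finite_or_finite_compl`). And `k`, seen as the plane
over `R`, has a lexicographic total order definable in `R` without parameters, because the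
nonnegative elements of `R` are the squares. A finite nonempty set then has a least element, a
cofinite proper subset is avoided by a greatest element `m` of its complement, so that `m + 1` lies
in the set, and for the whole line one takes `0`. Applied to projections and fibres in turn, this
gives a point `pick` in every nonempty `k`-definable subset of `k ^ n` (`pick_mem`). It depends only
on the set, hence agrees on isomorphic objects, and it varies definably in families
(`RealDefinable.eq_pick`).

Formulas over `k` become formulas over `R` by splitting each variable and each parameter into real
and imaginary parts (`definable_realize_boundedFormula`). -/

namespace ElimGroupoid

open FirstOrder

/-! ### Minimality of algebraically closed fields -/

section StronglyMinimal

/-- Both elements extend to transcendence bases of `U`, which have equal cardinality. A bijection of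
the bases taking `a` to `b` induces an isomorphism of polynomial subrings, and this extends to `U`,
an algebraic closure over either of them. -/
theorem exists_ringEquiv_of_transcendental {k : Type*} {U : Type*} [Field k] [Field U] [Algebra k U]
    [IsAlgClosed U] {a b : U} (ha : Transcendental k a) (hb : Transcendental k b) :
    ∃ σ : U ≃+* U, (∀ c, σ (algebraMap k U c) = algebraMap k U c) ∧ σ a = b := by
  classical
  obtain ⟨s, has, hs⟩ := exists_isTranscendenceBasis_superset (R := k) (s := {a})
    ((algebraicIndependent_unique_type_iff (ι := ({a} : Set U))).2 ha)
  obtain ⟨t, hbt, ht⟩ := exists_isTranscendenceBasis_superset (R := k) (s := {b})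
    ((algebraicIndependent_unique_type_iff (ι := ({b} : Set U))).2 hb)
  have hst : Cardinal.mk s = Cardinal.mk t := by
    rw [hs.cardinalMk_eq_trdeg, ht.cardinalMk_eq_trdeg]
  obtain ⟨f⟩ := Cardinal.eq.1 hst
  let a' : s := ⟨a, has rfl⟩
  let b' : t := ⟨b, hbt rfl⟩
  -- The swap corrects an arbitrary bijection so that it takes `a` to `b`.
  let g : s ≃ t := f.trans (Equiv.swap (f a') b')
  have hg : g a' = b' := by simp [g]
  let h : Algebra.adjoin k (Set.range ((↑) : s → U)) ≃ₐ[k]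
      Algebra.adjoin k (Set.range ((↑) : t → U)) :=
    hs.1.aevalEquiv.symm.trans ((MvPolynomial.renameEquiv k g).trans ht.1.aevalEquiv)
  have hh : h ⟨a, Algebra.subset_adjoin ⟨a', rfl⟩⟩ = ⟨b, Algebra.subset_adjoin ⟨b', rfl⟩⟩ := by
    have : hs.1.aevalEquiv (MvPolynomial.X a') = ⟨a, Algebra.subset_adjoin ⟨a', rfl⟩⟩ := by
      ext; simp [a']
    rw [← this]
    ext
    simp [h, hg, b']
  have := IsAlgClosed.isAlgClosure_of_transcendence_basis _ hs
  have := IsAlgClosed.isAlgClosure_of_transcendence_basis _ ht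
  refine ⟨IsAlgClosure.equivOfEquiv U U h.toRingEquiv, fun c => ?_, ?_⟩
  · have := IsAlgClosure.equivOfEquiv_algebraMap U U h.toRingEquiv (algebraMap k _ c)
    rw [← IsScalarTower.algebraMap_apply] at this
    rw [this]
    simp [← IsScalarTower.algebraMap_apply]
  · have := IsAlgClosure.equivOfEquiv_algebraMap U U h.toRingEquiv
      ⟨a, Algebra.subset_adjoin ⟨a', rfl⟩⟩
    simpa [hh] using! this

open FirstOrder.Ring FirstOrder.Field Filter

/-- A set defined in an algebraically closed field by a formula in one variable with parameters
cannot be both infinite and coinfinite. -/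
theorem finite_or_finite_compl_of_formula {k : Type*} [Field k] [IsAlgClosed k] [CompatibleRing k]
    (φ : Language.ring.Formula (k ⊕ Unit)) :
    {x : k | φ.Realize (Sum.elim id fun _ => x)}.Finite ∨
      {x : k | φ.Realize (Sum.elim id fun _ => x)}ᶜ.Finite := by
  by_contra! hD
  obtain ⟨h₁, h₂⟩ := hD
  obtain ⟨p, hp⟩ := CharP.exists k
  -- In the ultrapower `U`, a set both infinite and coinfinite yields two transcendental elements
  -- over `k`, one satisfying `φ` and one not; an automorphism over `k` exchanging them is a
  -- contradiction.
  let U := (hyperfilter ℕ : Filter ℕ).Product fun _ => k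
  have : (Language.Theory.ACF p).Model U := by
    refine ⟨fun ψ hψ => (Language.Ultraproduct.sentence_realize ψ).2 ?_⟩
    exact Eventually.of_forall fun _ =>
      (inferInstance : (Language.Theory.ACF p).Model k).realize_of_mem ψ hψ
  let _ := fieldOfModelACF p U
  have := modelField_of_modelACF p U
  let _ := compatibleRingOfModelField U
  have := isAlgClosed_of_model_ACF p U
  let mk : (ℕ → k) → U := fun f => (f : (hyperfilter ℕ : Filter ℕ).Product fun _ => k)
  have hmk : ∀ {n : ℕ} (g : Language.ring.Functions n) (x : Fin n → ℕ → k),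
      Language.Structure.funMap g (fun i => mk (x i)) =
        mk fun a => Language.Structure.funMap g fun i => x i a :=
    fun g x => Language.Ultraproduct.funMap_cast g x
  let c : k → U := fun x => mk fun _ => x
  let δ : k →+* U :=
    { toFun := c
      map_one' := by
        simpa only [CompatibleRing.funMap_one] using (hmk oneFunc fun _ _ => 0).symm
      map_zero' := by
        simpa only [CompatibleRing.funMap_zero] using (hmk zeroFunc fun _ _ => 0).symm
      map_mul' := fun x y => by
        simpa only [CompatibleRing.funMap_mul] using! (hmk mulFunc fun i _ => ![x, y] i).symm
      map_add' := fun x y => by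
        simpa only [CompatibleRing.funMap_add] using! (hmk addFunc fun i _ => ![x, y] i).symm }
  let _ : Algebra k U := δ.toAlgebra
  have htr : ∀ f : ℕ → k, Function.Injective f → Transcendental k (mk f) := by
    intro f hf halg
    -- An algebraic element would lie in `k`, so `f` would be constant on a set of the ultrafilter;
    -- such a set is infinite, while `f` is injective.
    have halg' := (IntermediateField.isAlgebraic_adjoin_simple halg.isIntegral :
      Algebra.IsAlgebraic k (IntermediateField.adjoin k {mk f}))
    obtain ⟨x, hx⟩ := (IsAlgClosed.algebraMap_bijective_of_isIntegral (k := k)).2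
      (IntermediateField.AdjoinSimple.gen k (mk f))
    replace hx : c x = mk f := congrArg Subtype.val hx
    have hx' : ∀ᶠ n in (hyperfilter ℕ : Filter ℕ), x = f n := Quotient.exact hx
    have : {n | x = f n}.Subsingleton := fun m hm n hn => hf (hm.symm.trans hn)
    exact notMem_hyperfilter_of_finite this.finite hx'
  let a := Set.Infinite.natEmbedding _ h₁
  let b := Set.Infinite.natEmbedding _ h₂
  have ha := htr (fun n => (a n).1) fun m n h => a.injective (Subtype.ext h)
  have hb := htr (fun n => (b n).1) fun m n h => b.injective (Subtype.ext h)
  obtain ⟨σ, hσ, hab⟩ := exists_ringEquiv_of_transcendental ha hb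
  -- Łoś's theorem, with the parameters of `φ` embedded as constant sequences.
  have key : ∀ f : ℕ → k, φ.Realize (Sum.elim c fun _ => (mk f)) ↔
      ∀ᶠ n in (hyperfilter ℕ : Filter ℕ), φ.Realize (Sum.elim id fun _ => f n) := by
    intro f
    have := Language.Ultraproduct.realize_formula_cast (u := hyperfilter ℕ) (M := fun _ => k)
      φ (Sum.elim (fun x _ => x) fun _ => f)
    have h₅ : (fun i => mk (Sum.elim (fun x _ => x) (fun _ => f) i)) =
        Sum.elim c fun _ : Unit => mk f := by
      ext i; cases i <;> rfl
    have h₆ : ∀ n, (fun i => Sum.elim (fun x (_ : ℕ) => x) (fun _ : Unit => f) i n) =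
        Sum.elim id fun _ => f n := by
      intro n; ext i; cases i <;> rfl
    simp only [h₆] at this
    rw [← h₅]
    exact this
  have h₃ := (key fun n => (a n).1).2 (Eventually.of_forall fun n => (a n).2)
  have h₄ : ¬ φ.Realize (Sum.elim c fun _ => mk fun n => (b n).1) := fun h => by
    obtain ⟨n, hn⟩ := ((key fun n => (b n).1).1 h).exists
    exact (b n).2 hn
  apply h₄
  let σ' : Language.ring.Equiv U U := languageEquivEquivRingEquiv.symm σ
  have := (Language.StrongHomClass.realize_formula σ' φ).2 h₃
  convert this using 1
  ext i
  rcases i with i | i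
  · exact (hσ i).symm
  · exact hab.symm

/-- Algebraically closed fields are minimal structures. -/
theorem IsDefinable.finite_or_finite_compl {k : Type*} [Field k] [IsAlgClosed k] {K : Set k}
    {S : Set (Unit → k)} (hS : IsDefinable K S) :
    {x : k | (fun _ => x) ∈ S}.Finite ∨ {x : k | (fun _ => x) ∈ S}ᶜ.Finite := by
  let _ := compatibleRingOfRing k
  obtain ⟨φ, rfl⟩ := Set.definable_iff_exists_formula_sum.1 hS
  have := finite_or_finite_compl_of_formula (φ.relabel (Sum.map ((↑) : K → k) id))
  convert this using 3 <;>
  · ext x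
    simp [Language.Formula.realize_relabel, Sum.elim_comp_map]

end StronglyMinimal

/-! ### Ring operations and squares in definable families -/

section DefinableRing

open FirstOrder.Ring Set

variable {F : Type*} [CommRing F] [CompatibleRing F] {A : Set F} {ι : Type*} {f g : (ι → F) → F}

theorem definableFun_add (hf : A.DefinableFun Language.ring f) (hg : A.DefinableFun Language.ring g) :
    A.DefinableFun Language.ring fun v => f v + g v := by
  have := DefinableFun.comp (g := fun v => ![f v, g v]) (A := A)
    (by simp [DefinableMap, hf, hg]) (DefinableFun.of_empty (DefinableFun.fun_symbol addFunc))
  simpa using! this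

theorem definableFun_mul (hf : A.DefinableFun Language.ring f) (hg : A.DefinableFun Language.ring g) :
    A.DefinableFun Language.ring fun v => f v * g v := by
  have := DefinableFun.comp (g := fun v => ![f v, g v]) (A := A)
    (by simp [DefinableMap, hf, hg]) (DefinableFun.of_empty (DefinableFun.fun_symbol mulFunc))
  simpa using! this

theorem definableFun_neg (hf : A.DefinableFun Language.ring f) :
    A.DefinableFun Language.ring fun v => -f v := by
  have := DefinableFun.comp (g := fun v => ![f v]) (A := A)
    (by simp [DefinableMap, hf]) (DefinableFun.of_empty (DefinableFun.fun_symbol negFunc))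
  simpa using! this

theorem definableFun_sub (hf : A.DefinableFun Language.ring f) (hg : A.DefinableFun Language.ring g) :
    A.DefinableFun Language.ring fun v => f v - g v := by
  simpa only [sub_eq_add_neg] using definableFun_add hf (definableFun_neg hg)

theorem definableFun_zero : A.DefinableFun Language.ring fun _ : ι → F => 0 := by
  have := DefinableFun.of_empty (A := A)
    (Language.Term.definableFun_realize (M := F) (0 : Language.ring.Term ι))
  simpa using! this

theorem definableFun_one : A.DefinableFun Language.ring fun _ : ι → F => 1 := by
  have := DefinableFun.of_empty (A := A)
    (Language.Term.definableFun_realize (M := F) (1 : Language.ring.Term ι))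
  simpa using! this

theorem definableFun_comp_right {κ : Type*} (hf : A.DefinableFun Language.ring f) (σ : ι → κ) :
    A.DefinableFun Language.ring fun v : κ → F => f (v ∘ σ) :=
  hf.preimage_comp (Option.map σ)

theorem definable_isSquare (hf : A.DefinableFun Language.ring f) :
    A.Definable Language.ring {v | IsSquare (f v)} := by
  have h := Definable.exists_of_finite (β := Unit) (DefinableFun.ofPred_eq
    (definableFun_comp_right hf Sum.inl)
    (definableFun_mul (A := A) (DefinableFun.proj (L := Language.ring) (i := (Sum.inr () : ι ⊕ Unit)))
      (DefinableFun.proj (L := Language.ring) (i := (Sum.inr () : ι ⊕ Unit)))))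
  convert h using 1
  ext v
  constructor
  · rintro ⟨s, hs⟩
    exact ⟨fun _ => s, hs⟩
  · rintro ⟨s, hs⟩
    exact ⟨s (), hs⟩

end DefinableRing

/-! ### Translation of formulas from `k` to `R` -/

section Realification

open FirstOrder.Ring Set QuadraticAlgebra

variable {R : Type*} {k : Type*} [Field R] [Field k] (e : k ≃+* Cplx R)

/-- The function `z : R ^ ι → k` has definable real and imaginary parts. -/
def ReImDefinable [CompatibleRing R] (A : Set R) {ι : Type*} (z : (ι → R) → k) : Prop :=
  A.DefinableFun Language.ring (fun v => (e (z v)).re) ∧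
    A.DefinableFun Language.ring fun v => (e (z v)).im

variable {e} [CompatibleRing R] [CompatibleRing k] {A : Set R}

theorem reImDefinable_realize {ι β : Type*} {z : (ι → R) → β → k}
    (hz : ∀ b, ReImDefinable e A fun v => z v b) (t : Language.ring.Term β) :
    ReImDefinable e A fun v => t.realize (z v) := by
  induction t with
  | var b => exact hz b
  | func f ts ih =>
    cases f with
    | add =>
      simp only [Language.Term.realize]
      constructor
      · simpa using! definableFun_add (ih 0).1 (ih 1).1
      · simpa using! definableFun_add (ih 0).2 (ih 1).2
    | mul =>
      simp only [Language.Term.realize]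
      constructor
      · simpa [sub_eq_add_neg] using! definableFun_sub (definableFun_mul (ih 0).1 (ih 1).1)
          (definableFun_mul (ih 0).2 (ih 1).2)
      · simpa using! definableFun_add (definableFun_mul (ih 0).1 (ih 1).2)
          (definableFun_mul (ih 0).2 (ih 1).1)
    | neg =>
      simp only [Language.Term.realize]
      constructor
      · simpa using! definableFun_neg (ih 0).1
      · simpa using! definableFun_neg (ih 0).2
    | zero =>
      simp only [Language.Term.realize]
      constructor
      · simpa using! definableFun_zero (A := A) (F := R) (ι := ι)
      · simpa using! definableFun_zero (A := A) (F := R) (ι := ι)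
    | one =>
      simp only [Language.Term.realize]
      constructor
      · simpa using! definableFun_one (A := A) (F := R) (ι := ι)
      · simpa using! definableFun_zero (A := A) (F := R) (ι := ι)

/-- An equation in `k` is a pair of equations in `R`, and a quantifier over `k` is a pair of
quantifiers over `R`. The index type `ι` is generalized because each quantifier adds two real
variables. -/
theorem definable_realize_boundedFormula {ι β : Type*} {n : ℕ}
    (φ : Language.ring.BoundedFormula β n) {z : (ι → R) → β → k} {x : (ι → R) → Fin n → k}
    (hz : ∀ b, ReImDefinable e A fun v => z v b) (hx : ∀ i, ReImDefinable e A fun v => x v i) :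
    A.Definable Language.ring {v | φ.Realize (z v) (x v)} := by
  induction φ generalizing ι with
  | falsum => exact definable_empty
  | equal t₁ t₂ =>
    have hzx : ∀ b, ReImDefinable e A fun v => Sum.elim (z v) (x v) b := by
      rintro (b | b)
      exacts [hz b, hx b]
    have h₁ := reImDefinable_realize hzx t₁
    have h₂ := reImDefinable_realize hzx t₂
    convert (DefinableFun.ofPred_eq h₁.1 h₂.1).inter (DefinableFun.ofPred_eq h₁.2 h₂.2) using 1
    ext v
    simp only [Language.BoundedFormula.Realize, mem_ofPred_eq, mem_inter_iff]
    rw [← QuadraticAlgebra.ext_iff, e.injective.eq_iff]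
  | rel r => cases r
  | imp φ ψ ih₁ ih₂ => exact (ih₁ hz hx).himp (ih₂ hz hx)
  | all φ ih =>
    -- The coordinates `false` and `true` carry the real and imaginary part of the bound variable.
    let z' : (ι ⊕ Bool → R) → _ → k := fun v => z (v ∘ Sum.inl)
    let x' : (ι ⊕ Bool → R) → Fin _ → k := fun v => Fin.snoc (x (v ∘ Sum.inl))
      (e.symm ⟨v (Sum.inr false), v (Sum.inr true)⟩)
    have hz' : ∀ b, ReImDefinable e A fun v => z' v b := fun b =>
      ⟨definableFun_comp_right (hz b).1 _, definableFun_comp_right (hz b).2 _⟩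
    have hx' : ∀ i, ReImDefinable e A fun v => x' v i := by
      intro i
      induction i using Fin.lastCases with
      | last => constructor <;> simpa [x'] using DefinableFun.proj (L := Language.ring) (A := A)
      | cast i =>
        constructor
        · simpa [x'] using definableFun_comp_right (hx i).1 _
        · simpa [x'] using definableFun_comp_right (hx i).2 _
    convert (ih hz' hx').forall_of_finite using 1
    ext v
    constructor
    · intro h u
      exact h _
    · intro h c
      simpa [z', x'] using h fun b => bif b then (e c).im else (e c).re

end Realification

/-! ### Predicates on powers of `k` that are definable in `R` -/

section RealDefinable

open FirstOrder.Ring Set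

variable {R : Type*} {k : Type*} [Field R] [Field k] (e : k ≃+* Cplx R)

/-- The predicate `p` on `k ^ ι` is definable over `A` when `k ^ ι` is identified with
`R ^ (ι ⊕ ι)`. -/
def RealDefinable (A : Set R) {ι : Type*} (p : (ι → k) → Prop) : Prop :=
  IsDefinable A {r : ι ⊕ ι → R | p ((realCoords e ι).symm r)}

variable {e} {A : Set R} {ι κ : Type*} {p q : (ι → k) → Prop}

theorem realDefinable_mem_iff {S : Set (ι → k)} :
    RealDefinable e A (· ∈ S) ↔ IsDefinable A (realCoords e ι '' S) := by
  rw [Equiv.image_eq_preimage_symm]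
  rfl

theorem IsDefinable.realDefinable {K : Set k} {S : Set (ι → k)} (hS : IsDefinable K S) :
    RealDefinable e (realParams e K) (· ∈ S) := by
  let _ := compatibleRingOfRing R
  let _ := compatibleRingOfRing k
  obtain ⟨φ, rfl⟩ := definable_iff_exists_formula_sum.1 hS
  refine definable_realize_boundedFormula (e := e)
    (z := fun r => Sum.elim (↑) ((realCoords e ι).symm r)) (x := fun _ => default) φ ?_
    fun i => i.elim0
  rintro (b | b)
  · have hre : (e b).re ∈ realParams e K := Or.inl ⟨b, b.2, rfl⟩
    have him : (e b).im ∈ realParams e K := Or.inr ⟨b, b.2, rfl⟩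
    exact ⟨Language.definableFun_const _ _ hre, Language.definableFun_const _ _ him⟩
  · constructor
    · simpa [realCoords] using DefinableFun.proj (L := Language.ring)
    · simpa [realCoords] using DefinableFun.proj (L := Language.ring)

namespace RealDefinable

theorem and (hp : RealDefinable e A p) (hq : RealDefinable e A q) :
    RealDefinable e A fun v => p v ∧ q v :=
  letI := compatibleRingOfRing R
  Definable.inter hp hq

theorem not (hp : RealDefinable e A p) : RealDefinable e A fun v => ¬ p v :=
  letI := compatibleRingOfRing R
  Definable.compl hp

theorem or (hp : RealDefinable e A p) (hq : RealDefinable e A q) :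
    RealDefinable e A fun v => p v ∨ q v :=
  letI := compatibleRingOfRing R
  Definable.union hp hq

theorem comp (hp : RealDefinable e A p) (σ : ι → κ) :
    RealDefinable e A fun v : κ → k => p (v ∘ σ) :=
  letI := compatibleRingOfRing R
  Definable.preimage_comp (Sum.map σ σ) hp

theorem exists_block [Finite κ] {p : (ι ⊕ κ → k) → Prop} (hp : RealDefinable e A p) :
    RealDefinable e A fun v => ∃ w : κ → k, p (Sum.elim v w) := by
  let _ := compatibleRingOfRing R
  have h := Definable.exists_of_finite (Definable.preimage_comp (Equiv.sumSumSumComm ι κ ι κ) hp)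
  change A.Definable Language.ring _
  convert h using 1
  ext r
  have key : ∀ u : κ ⊕ κ → R, (realCoords e (ι ⊕ κ)).symm
      (Sum.elim r u ∘ Equiv.sumSumSumComm ι κ ι κ) =
        Sum.elim ((realCoords e ι).symm r) ((realCoords e κ).symm u) := by
    intro u
    ext i
    cases i <;> rfl
  simp only [mem_ofPred_eq, mem_preimage, key]
  exact ((realCoords e κ).symm.surjective.exists
    (p := fun w => p (Sum.elim ((realCoords e ι).symm r) w)))

theorem exists_coord {p : (ι → k) → k → Prop}
    (hp : RealDefinable e A fun u : ι ⊕ Unit → k => p (u ∘ Sum.inl) (u (Sum.inr ()))) :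
    RealDefinable e A fun v => ∃ x, p v x := by
  convert hp.exists_block using 2 with v
  exact ⟨fun ⟨x, hx⟩ => ⟨fun _ => x, hx⟩, fun ⟨x, hx⟩ => ⟨x (), hx⟩⟩

end RealDefinable
end RealDefinable

/-! ### The lexicographic order on `k` -/

section Order

variable {R : Type*} {k : Type*} [Field R] [Field k]

/-- The lexicographic order on `k = R + √-1 R`, where `R` carries the order whose nonnegative
elements are the squares. -/
def LexLE (e : k ≃+* Cplx R) (x y : k) : Prop :=
  ((e (y - x)).re ≠ 0 ∧ IsSquare (e (y - x)).re) ∨ ((e (y - x)).re = 0 ∧ IsSquare (e (y - x)).im)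

variable {e : k ≃+* Cplx R}

theorem realDefinable_lexLE {A : Set R} {ι : Type*} (i j : ι) :
    RealDefinable e A fun v : ι → k => LexLE e (v i) (v j) := by
  let _ := Ring.compatibleRingOfRing R
  have hre := definableFun_sub (Set.DefinableFun.proj (L := Language.ring) (A := A)
    (i := (Sum.inl j : ι ⊕ ι)))
    (Set.DefinableFun.proj (L := Language.ring) (A := A)
    (i := (Sum.inl i : ι ⊕ ι)))
  have him := definableFun_sub (Set.DefinableFun.proj (L := Language.ring) (A := A)
    (i := (Sum.inr j : ι ⊕ ι)))
    (Set.DefinableFun.proj (L := Language.ring) (A := A)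
    (i := (Sum.inr i : ι ⊕ ι)))
  have h0 := (Set.DefinableFun.ofPred_eq hre (definableFun_zero (A := A)))
  change A.Definable Language.ring _
  convert (h0.compl.inter (definable_isSquare hre)).union (h0.inter (definable_isSquare him)) using 1
  ext r
  simp [LexLE, realCoords]

variable [IsRealClosed R]

/-- Otherwise minus the sum is a nonzero square `u * u`, and division by it writes `-1` as a sum of
two squares. -/
theorem IsRealClosed.isSquare_add {a b : R} (ha : IsSquare a) (hb : IsSquare b) :
    IsSquare (a + b) := by
  obtain h | ⟨u, hu⟩ := IsRealClosed.isSquare_or_isSquare_neg (a + b)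
  · exact h
  obtain rfl | hu0 := eq_or_ne u 0
  · rw [neg_eq_iff_eq_neg.1 hu]
    simp
  obtain ⟨s, rfl⟩ := ha
  obtain ⟨t, rfl⟩ := hb
  refine absurd ?_ (IsSemireal.not_isSumSq_neg_one R)
  have : (-1 : R) = s / u * (s / u) + t / u * (t / u) := by
    field_simp
    linear_combination hu
  rw [this]
  exact (IsSumSq.mul_self _).add (IsSumSq.mul_self _)

theorem IsRealClosed.eq_zero_of_isSquare_neg {a : R} (ha : IsSquare a) (hb : IsSquare (-a)) :
    a = 0 := by
  obtain ⟨s, rfl⟩ := ha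
  obtain ⟨t, ht⟩ := hb
  by_contra hs
  have hs0 : s ≠ 0 := fun h => hs (by simp [h])
  refine absurd ?_ (IsSemireal.not_isSumSq_neg_one R)
  have : (-1 : R) = t / s * (t / s) := by
    field_simp
    linear_combination ht
  rw [this]
  exact IsSumSq.mul_self _

theorem lexLE_total (x y : k) : LexLE e x y ∨ LexLE e y x := by
  have hz : e (x - y) = -e (y - x) := by rw [← map_neg, neg_sub]
  simp only [LexLE, hz, QuadraticAlgebra.re_neg, QuadraticAlgebra.im_neg, neg_eq_zero, ne_eq]
  have h₁ := IsRealClosed.isSquare_or_isSquare_neg (e (y - x)).re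
  have h₂ := IsRealClosed.isSquare_or_isSquare_neg (e (y - x)).im
  tauto

theorem lexLE_antisymm {x y : k} (h₁ : LexLE e x y) (h₂ : LexLE e y x) : x = y := by
  have hz : e (x - y) = -e (y - x) := by rw [← map_neg, neg_sub]
  simp only [LexLE, hz, QuadraticAlgebra.re_neg, QuadraticAlgebra.im_neg, neg_eq_zero, ne_eq]
    at h₁ h₂
  have h₃ := IsRealClosed.eq_zero_of_isSquare_neg (a := (e (y - x)).re)
  have h₄ := IsRealClosed.eq_zero_of_isSquare_neg (a := (e (y - x)).im)
  have : e (y - x) = 0 := by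
    ext <;> simp only [QuadraticAlgebra.re_zero, QuadraticAlgebra.im_zero] <;> tauto
  rw [map_eq_zero_iff e e.injective, sub_eq_zero] at this
  exact this.symm

theorem lexLE_trans {x y z : k} (h₁ : LexLE e x y) (h₂ : LexLE e y z) : LexLE e x z := by
  have hz : e (z - x) = e (y - x) + e (z - y) := by rw [← map_add]; congr 1; ring
  simp only [LexLE, hz, QuadraticAlgebra.re_add, QuadraticAlgebra.im_add] at h₁ h₂ ⊢
  generalize e (y - x) = a, e (z - y) = b at h₁ h₂ ⊢
  obtain ⟨h₁, h₁'⟩ | ⟨h₁, h₁'⟩ := h₁ <;> obtain ⟨h₂, h₂'⟩ | ⟨h₂, h₂'⟩ := h₂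
  · refine .inl ⟨fun h => h₁ (IsRealClosed.eq_zero_of_isSquare_neg h₁' ?_),
      IsRealClosed.isSquare_add h₁' h₂'⟩
    rwa [neg_eq_of_add_eq_zero_right h]
  · simp [h₁, h₂, h₁']
  · simp [h₁, h₂, h₂']
  · simp [h₁, h₂, IsRealClosed.isSquare_add h₁' h₂']

theorem lexLE_add_one (x : k) : LexLE e x (x + 1) := by
  simp [LexLE, QuadraticAlgebra.re_one]

theorem exists_lexLE_least {D : Set k} (hD : D.Finite) (hne : D.Nonempty) :
    ∃ m ∈ D, ∀ x ∈ D, LexLE e m x := by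
  induction D, hD using Set.Finite.induction_on with
  | empty => exact absurd hne Set.not_nonempty_empty
  | @insert a D _ _ ih =>
    obtain rfl | hne := D.eq_empty_or_nonempty
    · exact ⟨a, by simpa using lexLE_total a a⟩
    obtain ⟨m, hm, hmD⟩ := ih hne
    obtain h | h := lexLE_total (e := e) m a
    · exact ⟨m, .inr hm, Set.forall_mem_insert.2 ⟨h, hmD⟩⟩
    · exact ⟨a, .inl rfl, Set.forall_mem_insert.2
        ⟨(or_self_iff.1 (lexLE_total a a)), fun x hx => lexLE_trans h (hmD x hx)⟩⟩

theorem exists_lexLE_greatest {D : Set k} (hD : D.Finite) (hne : D.Nonempty) :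
    ∃ m ∈ D, ∀ x ∈ D, LexLE e x m := by
  induction D, hD using Set.Finite.induction_on with
  | empty => exact absurd hne Set.not_nonempty_empty
  | @insert a D _ _ ih =>
    obtain rfl | hne := D.eq_empty_or_nonempty
    · exact ⟨a, by simpa using lexLE_total a a⟩
    obtain ⟨m, hm, hmD⟩ := ih hne
    obtain h | h := lexLE_total (e := e) a m
    · exact ⟨m, .inr hm, Set.forall_mem_insert.2 ⟨h, hmD⟩⟩
    · exact ⟨a, .inl rfl, Set.forall_mem_insert.2
        ⟨(or_self_iff.1 (lexLE_total a a)), fun x hx => lexLE_trans (hmD x hx) h⟩⟩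

end Order

/-! ### Canonical points of definable sets -/

section Choice

variable {R : Type*} {k : Type*} [Field R] [Field k] (e : k ≃+* Cplx R)

/-- `m` is the lexicographically least element of `D`. -/
def IsLexLeast (D : Set k) (m : k) : Prop := m ∈ D ∧ ¬ ∃ x, x ∈ D ∧ ¬ LexLE e m x

/-- `m` is the lexicographically greatest element of `D`. -/
def IsLexGreatest (D : Set k) (m : k) : Prop := m ∈ D ∧ ¬ ∃ x, x ∈ D ∧ ¬ LexLE e x m

open Classical in
/-- A canonical element of a nonempty finite or cofinite set `D`: its least element if it has one,
or else the successor of the greatest element of the complement. -/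
noncomputable def pickOne (D : Set k) : k :=
  if h : ∃ m, IsLexLeast e D m then h.choose
  else if h : ∃ m, IsLexGreatest e Dᶜ m then h.choose + 1 else 0

/-- A canonical element of a nonempty definable subset of `k ^ n`, chosen coordinate by
coordinate. -/
noncomputable def pick : (n : ℕ) → Set (Fin n → k) → Fin n → k
  | 0, _ => Fin.elim0
  | n + 1, C =>
    let a := pickOne e {x | ∃ y : Fin n → k, (Fin.cons x y : Fin (n + 1) → k) ∈ C}
    Fin.cons a (pick n {y | (Fin.cons a y : Fin (n + 1) → k) ∈ C})

variable {e}

section Definability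

variable {A : Set R} {ι : Type*}

theorem RealDefinable.isLexLeast {p : (ι → k) → k → Prop}
    (hp : RealDefinable e A fun u : ι ⊕ Unit → k => p (u ∘ Sum.inl) (u (Sum.inr ()))) :
    RealDefinable e A fun u : ι ⊕ Unit → k =>
      IsLexLeast e {x | p (u ∘ Sum.inl) x} (u (Sum.inr ())) :=
  hp.and (RealDefinable.exists_coord (p := fun u x => p (u ∘ Sum.inl) x ∧ ¬ LexLE e (u (Sum.inr ())) x)
    ((hp.comp (Sum.elim (Sum.inl ∘ Sum.inl) Sum.inr)).and
      (realDefinable_lexLE (Sum.inl (Sum.inr ())) (Sum.inr ())).not)).not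

theorem RealDefinable.isLexGreatest {p : (ι → k) → k → Prop}
    (hp : RealDefinable e A fun u : ι ⊕ Unit → k => p (u ∘ Sum.inl) (u (Sum.inr ()))) :
    RealDefinable e A fun u : ι ⊕ Unit → k =>
      IsLexGreatest e {x | p (u ∘ Sum.inl) x} (u (Sum.inr ())) :=
  hp.and (RealDefinable.exists_coord (p := fun u x => p (u ∘ Sum.inl) x ∧ ¬ LexLE e x (u (Sum.inr ())))
    ((hp.comp (Sum.elim (Sum.inl ∘ Sum.inl) Sum.inr)).and
      (realDefinable_lexLE (Sum.inr ()) (Sum.inl (Sum.inr ()))).not)).not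

variable {K : Set k}

theorem realDefinable_eq_add_one (i j : ι) :
    RealDefinable e (realParams e K) fun v : ι → k => v i = v j + 1 := by
  let _ := Ring.compatibleRingOfRing k
  have h : IsDefinable K {v : ι → k | v i = v j + 1} :=
    Set.DefinableFun.ofPred_eq (Set.DefinableFun.proj _)
      (definableFun_add (Set.DefinableFun.proj _) definableFun_one)
  exact h.realDefinable

theorem realDefinable_eq_zero (i : ι) :
    RealDefinable e (realParams e K) fun v : ι → k => v i = 0 := by
  let _ := Ring.compatibleRingOfRing k
  have h : IsDefinable K {v : ι → k | v i = 0} :=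
    Set.DefinableFun.ofPred_eq (Set.DefinableFun.proj _) definableFun_zero
  exact h.realDefinable

variable [IsRealClosed R]

theorem IsLexLeast.unique {D : Set k} {m m' : k} (h : IsLexLeast e D m) (h' : IsLexLeast e D m') :
    m = m' :=
  lexLE_antisymm (not_not.1 fun hn => h.2 ⟨m', h'.1, hn⟩) (not_not.1 fun hn => h'.2 ⟨m, h.1, hn⟩)

theorem IsLexGreatest.unique {D : Set k} {m m' : k} (h : IsLexGreatest e D m)
    (h' : IsLexGreatest e D m') : m = m' :=
  lexLE_antisymm (not_not.1 fun hn => h'.2 ⟨m, h.1, hn⟩) (not_not.1 fun hn => h.2 ⟨m', h'.1, hn⟩)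

/-- This replaces the choices in `pickOne` by a first-order condition, from which definability can
be read off; uniqueness of extremal elements makes the two agree. -/
theorem eq_pickOne_iff {D : Set k} {y : k} :
    y = pickOne e D ↔ IsLexLeast e D y ∨ (¬ ∃ m, IsLexLeast e D m) ∧
      ((∃ m, IsLexGreatest e Dᶜ m ∧ y = m + 1) ∨ (¬ ∃ m, IsLexGreatest e Dᶜ m) ∧ y = 0) := by
  unfold pickOne
  split_ifs with h₁ h₂
  · simp only [h₁, not_true_eq_false, false_and, or_false]
    exact ⟨fun h => h ▸ h₁.choose_spec, fun h => h.unique h₁.choose_spec⟩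
  · have : ¬ IsLexLeast e D y := fun h => h₁ ⟨y, h⟩
    simp only [h₁, h₂, this, not_true_eq_false, not_false_eq_true, false_and, or_false, true_and,
      false_or]
    exact ⟨fun h => ⟨_, h₂.choose_spec, h⟩, fun ⟨m, hm, h⟩ => h₂.choose_spec.unique hm ▸ h⟩
  · have h₃ : ¬ IsLexLeast e D y := fun h => h₁ ⟨y, h⟩
    have h₄ : ¬ ∃ m, IsLexGreatest e Dᶜ m ∧ y = m + 1 := fun ⟨m, hm, _⟩ => h₂ ⟨m, hm⟩
    simp only [h₁, h₂, h₃, h₄, not_false_eq_true, true_and, false_or]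

theorem RealDefinable.eq_pickOne {p : (ι → k) → k → Prop}
    (hp : RealDefinable e (realParams e K)
      fun u : ι ⊕ Unit → k => p (u ∘ Sum.inl) (u (Sum.inr ()))) :
    RealDefinable e (realParams e K) fun u : ι ⊕ Unit → k =>
      u (Sum.inr ()) = pickOne e {x | p (u ∘ Sum.inl) x} := by
  simp only [eq_pickOne_iff]
  have hg := RealDefinable.isLexGreatest (p := fun v x => ¬ p v x) hp.not
  have h₁ := (RealDefinable.exists_coord (p := fun v m => IsLexLeast e {x | p v x} m)
    hp.isLexLeast).comp (Sum.inl : ι → ι ⊕ Unit)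
  have h₂ := (RealDefinable.exists_coord (p := fun v m => IsLexGreatest e {x | ¬ p v x} m)
    hg).comp (Sum.inl : ι → ι ⊕ Unit)
  have h₃ := RealDefinable.exists_coord
    (p := fun u m => IsLexGreatest e {x | ¬ p (u ∘ Sum.inl) x} m ∧ u (Sum.inr ()) = m + 1)
    ((hg.comp (Sum.elim (Sum.inl ∘ Sum.inl) Sum.inr)).and
      (realDefinable_eq_add_one (Sum.inl (Sum.inr ())) (Sum.inr ())))
  exact hp.isLexLeast.or (h₁.not.and (h₃.or (h₂.not.and (realDefinable_eq_zero _))))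

/-- The uniform version in a family of sets. In the induction the first chosen coordinate joins the
parameters of the family, which is why `ι` varies. -/
theorem RealDefinable.eq_pick {n : ℕ} {ι : Type*} {p : (ι → k) → (Fin n → k) → Prop}
    (hp : RealDefinable e (realParams e K)
      fun u : ι ⊕ Fin n → k => p (u ∘ Sum.inl) (u ∘ Sum.inr)) :
    RealDefinable e (realParams e K) fun u : ι ⊕ Fin n → k =>
      u ∘ Sum.inr = pick e n {y | p (u ∘ Sum.inl) y} := by
  induction n generalizing ι with
  | zero =>
    have : RealDefinable e (realParams e K) fun _ : ι ⊕ Fin 0 → k => True :=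
      letI := Ring.compatibleRingOfRing R
      Set.definable_univ
    convert this using 2 with u
    simpa using Subsingleton.elim _ _
  | succ n ih =>
    let p₁ : (ι → k) → k → Prop := fun v x => ∃ y : Fin n → k, p v (Fin.cons x y)
    have h₁ : RealDefinable e (realParams e K)
        fun u : ι ⊕ Unit → k => p₁ (u ∘ Sum.inl) (u (Sum.inr ())) := by
      have := (hp.comp (Sum.elim (Sum.inl ∘ Sum.inl) (Fin.cons (Sum.inl (Sum.inr ())) Sum.inr :
        Fin (n + 1) → (ι ⊕ Unit) ⊕ Fin n))).exists_block
      convert this using 4 with u y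
      congr! 1
      funext i
      induction i using Fin.cases <;> rfl
    let p₂ : (ι ⊕ Unit → k) → (Fin n → k) → Prop :=
      fun u y => p (u ∘ Sum.inl) (Fin.cons (u (Sum.inr ())) y)
    have h₂ : RealDefinable e (realParams e K)
        fun u : (ι ⊕ Unit) ⊕ Fin n → k => p₂ (u ∘ Sum.inl) (u ∘ Sum.inr) := by
      have := (hp.comp (Sum.elim (Sum.inl ∘ Sum.inl) (Fin.cons (Sum.inl (Sum.inr ())) Sum.inr :
        Fin (n + 1) → (ι ⊕ Unit) ⊕ Fin n)))
      convert this using 2 with u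
      refine iff_of_eq (congrArg (p (fun i => u (Sum.inl (Sum.inl i)))) (funext fun i => ?_))
      induction i using Fin.cases <;> rfl
    convert (h₁.eq_pickOne.comp (Sum.elim Sum.inl fun _ => Sum.inr 0)).and
      ((ih h₂).comp (Sum.elim (Sum.elim Sum.inl fun _ => Sum.inr 0) (Sum.inr ∘ Fin.succ)))
      using 2 with u
    have hu : u ∘ Sum.inr = Fin.cons (u (Sum.inr 0)) ((u ∘ Sum.inr) ∘ Fin.succ) :=
      (Fin.cons_self_tail (u ∘ Sum.inr)).symm
    rw [pick, hu, Fin.cons_inj]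
    constructor
    · rintro ⟨h, h'⟩
      refine ⟨h, ?_⟩
      rw [← h] at h'
      exact h'
    · rintro ⟨h, h'⟩
      refine ⟨h, ?_⟩
      change u (Sum.inr 0) = pickOne e {x | ∃ y, Fin.cons x y ∈ {y | p (u ∘ Sum.inl) y}} at h
      rw [← h]
      exact h'

end Definability

variable [IsRealClosed R]

theorem pickOne_mem {D : Set k} (hD : D.Finite ∨ Dᶜ.Finite) (hne : D.Nonempty) :
    pickOne e D ∈ D := by
  obtain h | ⟨h₁, ⟨m, hm, h⟩ | ⟨h₂, h⟩⟩ := eq_pickOne_iff.1 (Eq.refl (pickOne e D))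
  · exact h.1
  -- If `m + 1` were in the complement it would be at most `m`, the greatest element there, although
  -- it lies strictly above `m`.
  · rw [h]
    by_contra hm'
    have := lexLE_antisymm (not_not.1 fun hn => hm.2 ⟨m + 1, hm', hn⟩) (lexLE_add_one m)
    simp at this
  -- The default value `0` is reached only when the complement is empty, since the other finite or
  -- cofinite sets have one of the two extrema.
  · obtain hD | hD := hD
    · obtain ⟨m, hm, hmD⟩ := exists_lexLE_least (e := e) hD hne
      exact absurd ⟨m, hm, fun ⟨x, hx, hx'⟩ => hx' (hmD x hx)⟩ h₁
    · obtain hc | hc := Dᶜ.eq_empty_or_nonempty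
      · rw [Set.compl_empty_iff.1 hc]
        trivial
      obtain ⟨m, hm, hmD⟩ := exists_lexLE_greatest (e := e) hD hc
      exact absurd ⟨m, hm, fun ⟨x, hx, hx'⟩ => hx' (hmD x hx)⟩ h₂

variable [IsAlgClosed k]

/-- Projections of `C` to the first coordinate are definable in `k`, so minimality applies at every
stage. -/
theorem pick_mem {K : Set k} {n : ℕ} {C : Set (Fin n → k)} (hC : IsDefinable K C)
    (hne : C.Nonempty) : pick e n C ∈ C := by
  let _ := Ring.compatibleRingOfRing k
  -- The fibre over the chosen coordinate `a` needs `a` as a parameter. Membership does not depend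
  -- on the parameter set, so all of `k` is allowed.
  replace hC : IsDefinable Set.univ C := Set.Definable.mono hC (Set.subset_univ K)
  induction n with
  | zero =>
    obtain ⟨y, hy⟩ := hne
    rwa [Subsingleton.elim (pick e 0 C) y]
  | succ n ih =>
    have hD : IsDefinable Set.univ
        {v : Unit → k | ∃ y : Fin n → k, (Fin.cons (v ()) y : Fin (n + 1) → k) ∈ C} := by
      have := Set.Definable.exists_of_finite (Set.Definable.preimage_comp
        (Fin.cons (Sum.inl ()) Sum.inr : Fin (n + 1) → Unit ⊕ Fin n) hC)
      change Set.univ.Definable Language.ring _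
      convert this using 4 with v
      funext y
      refine (congrArg (· ∈ C) (funext fun i => ?_))
      induction i using Fin.cases <;> rfl
    obtain ⟨y, hy⟩ := hne
    rw [pick]
    set a := pickOne e {x | ∃ y : Fin n → k, (Fin.cons x y : Fin (n + 1) → k) ∈ C}
    obtain ⟨z, hz⟩ : a ∈ {x | ∃ y : Fin n → k, (Fin.cons x y : Fin (n + 1) → k) ∈ C} :=
      pickOne_mem hD.finite_or_finite_compl ⟨y 0, Fin.tail y, by simpa using hy⟩
    refine ih (C := {y | (Fin.cons a y : Fin (n + 1) → k) ∈ C}) ⟨z, hz⟩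
      (Set.Definable.preimage_map (F := fun y => (Fin.cons a y : Fin (n + 1) → k))
        (fun i => ?_) hC)
    induction i using Fin.cases with
    | zero => exact Language.definableFun_const _ _ (Set.mem_univ a)
    | succ i => exact Set.DefinableFun.proj _

end Choice

/-! ### From definability in `k` to groupoids and maps in `R` -/

section Transport

variable {R : Type*} {k : Type*} [Field R] [Field k] {e : k ≃+* Cplx R} {A : Set R}
  {ι κ μ : Type*} [Finite ι] [Finite κ] [Finite μ]

theorem RealDefinable.isDefinable_range_sumElim {T : Type*} {a : T → ι → k} {b : T → κ → k}
    (h : RealDefinable e A (· ∈ Set.range fun t => (Sum.elim (a t) (b t) : ι ⊕ κ → k))) :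
    IsDefinable A (Set.range fun t =>
      (Sum.elim (realCoords e ι (a t)) (realCoords e κ (b t)) : (ι ⊕ ι) ⊕ (κ ⊕ κ) → R)) := by
  let _ := Ring.compatibleRingOfRing R
  have := Set.Definable.image_comp (realDefinable_mem_iff.1 h) (Equiv.sumSumSumComm ι ι κ κ)
  change A.Definable Language.ring _
  rw [← Set.range_comp, ← Set.range_comp] at this
  convert this using 2
  ext t i
  rcases i with (i | i) | (i | i) <;> rfl

theorem RealDefinable.isDefinable_range_sumElim₃ {T : Type*} {a : T → ι → k} {b : T → κ → k}
    {c : T → μ → k} (h : RealDefinable e A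
      (· ∈ Set.range fun t => (Sum.elim (a t) (Sum.elim (b t) (c t)) : ι ⊕ (κ ⊕ μ) → k))) :
    IsDefinable A (Set.range fun t => (Sum.elim (realCoords e ι (a t))
      (Sum.elim (realCoords e κ (b t)) (realCoords e μ (c t))) :
        (ι ⊕ ι) ⊕ ((κ ⊕ κ) ⊕ (μ ⊕ μ)) → R)) := by
  let _ := Ring.compatibleRingOfRing R
  have := Set.Definable.image_comp h.isDefinable_range_sumElim
    ((Equiv.refl (ι ⊕ ι)).sumCongr (Equiv.sumSumSumComm κ κ μ μ))
  change A.Definable Language.ring _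
  rw [← Set.range_comp] at this
  convert this using 2
  ext t i
  rcases i with (i | i) | (i | i) | (i | i) <;> rfl

/-- A map definable in `R` stays so when its domain and range are regarded as subsets of powers
of `R`. -/
theorem RealDefinable.isDefinableMap {X : Set (ι → k)} {Y : Set (κ → k)} {f : X → Y}
    (hf : RealDefinable e A (· ∈ Set.range fun x : X => (Sum.elim x.1 (f x).1 : ι ⊕ κ → k))) :
    IsDefinableMap A fun x => (realCoords e κ).image Y (f (((realCoords e ι).image X).symm x)) := by
  have h := hf.isDefinable_range_sumElim
  unfold IsDefinableMap
  rw [← ((realCoords e ι).image X).surjective.range_comp]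
  convert h using 3
  simp

theorem Gpd.DefinableOver.toReal {K : Set k} {X₀ : Set (ι → k)} {X₁ : Set (κ → k)}
    {X : Gpd X₀ X₁} (hX : X.DefinableOver K) : (X.toReal e).DefinableOver (realParams e K) where
  obj := realDefinable_mem_iff.1 hX.obj.realDefinable
  arrow := realDefinable_mem_iff.1 hX.arrow.realDefinable
  src := (IsDefinable.realDefinable hX.src).isDefinableMap
  tgt := (IsDefinable.realDefinable hX.tgt).isDefinableMap
  inv := (IsDefinable.realDefinable hX.inv).isDefinableMap
  one := (IsDefinable.realDefinable hX.one).isDefinableMap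
  comp := by
    have h := (IsDefinable.realDefinable (e := e) hX.comp).isDefinable_range_sumElim₃
    convert h using 1
    let E := (realCoords e κ).image X₁
    let E' : {p : X₁ × X₁ // X.src p.1 = X.tgt p.2} → {p : (realCoords e κ '' X₁ : Set _) ×
        (realCoords e κ '' X₁ : Set _) // (X.toReal e).src p.1 = (X.toReal e).tgt p.2} :=
      fun p => ⟨(E p.1.1, E p.1.2), by simpa [Gpd.toReal, Gpd.transport, E] using p.2⟩
    have hE : Function.Surjective E' := fun ⟨⟨x, y⟩, h⟩ => ⟨⟨(E.symm x, E.symm y),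
      ((realCoords e ι).image X₀).injective h⟩, by simp [E']⟩
    rw [← hE.range_comp]
    refine congrArg Set.range (funext fun p => ?_)
    simp [E', E, Gpd.toReal, Gpd.transport]

end Transport

/-! ### Torsors from representatives -/

namespace Gpd

section Eliminable

/-- The same torsor after renaming its points and those of its base along bijections. -/
def Torsor.transport {O M P Y P' Y' : Type*} {X : Gpd O M} (T : X.Torsor P Y) (a : P ≃ P')
    (b : Y ≃ Y') : X.Torsor P' Y' where
  proj q := b (T.proj (a.symm q))
  anchor q := T.anchor (a.symm q)
  act m q h := a (T.act m (a.symm q) h)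
  proj_act m q h := by simp [T.proj_act]
  anchor_act m q h := by simp [T.anchor_act]
  one_act q := by simp [T.one_act]
  comp_act n m q h h' := by
    simpa using T.comp_act n m _ h h'
  proj_surjective := b.surjective.comp (T.proj_surjective.comp a.symm.surjective)
  existsUnique_act q q' h := by
    simpa [Equiv.eq_symm_apply] using T.existsUnique_act (a.symm q) (a.symm q') (b.injective h)

/-- The set of arrows with source in a set of representatives of the isomorphism classes is a
torsor under left composition. -/
def representativeTorsor {O M : Type*} (X : Gpd O M) (ρ : O → O) :
    X.Torsor {m : M // ρ (X.src m) = X.src m} {x : O // ρ x = x} where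
  proj m := ⟨X.src m.1, m.2⟩
  anchor m := X.tgt m.1
  act m q h := ⟨X.comp m q.1 h, by simpa [X.src_comp] using q.2⟩
  proj_act m q h := Subtype.ext (X.src_comp _ _ _)
  anchor_act m q h := X.tgt_comp _ _ _
  one_act q := Subtype.ext (X.one_comp _)
  comp_act n m q h h' := Subtype.ext (X.assoc _ _ _ _ _)
  proj_surjective x := ⟨⟨X.one x.1, by simpa [X.src_one] using x.2⟩, Subtype.ext (X.src_one _)⟩
  existsUnique_act q q' h := by
    have hsrc : X.src q.1 = X.src q'.1 := congrArg Subtype.val h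
    refine ⟨X.comp q'.1 (X.inv q.1) ((X.tgt_inv _).trans hsrc).symm,
      ⟨(X.src_comp _ _ _).trans (X.src_inv _), Subtype.ext ?_⟩, ?_⟩
    · refine (X.assoc _ _ _ _ (X.src_inv _)).trans ?_
      simp only [X.inv_comp, hsrc, X.comp_one]
    · rintro m ⟨hm, rfl⟩
      refine Eq.symm ((X.assoc _ _ _ hm (X.tgt_inv _).symm).trans ?_)
      simp only [X.comp_inv, ← hm, X.comp_one]

variable {F : Type*} [CommRing F] {ι κ : Type*}
  {X₀ : Set (ι → F)} {X₁ : Set (κ → F)} {X : Gpd X₀ X₁} {K : Set F}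

/-- Real coordinates are indexed by sums of finite types, whereas `EliminableOver` asks for `Fin`;
the torsor is reindexed. -/
theorem eliminableOver_of_torsor {ι' κ' : Type*} [Finite ι'] [Finite κ']
    {Y : Set (ι' → F)} {π : X₀ → Y} {P : Set (κ' → F)}
    (T : X.Torsor P Y) (hY : IsDefinable K Y) (hπ : IsDefinableMap K π) (hπX : X.IsQuotientMap π)
    (hP : IsDefinable K P) (hproj : IsDefinableMap K T.proj) (hanchor : IsDefinableMap K T.anchor)
    (hact : IsDefinable K (Set.range fun p : {p : X₁ × P // X.src p.1 = T.anchor p.2} =>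
      (Sum.elim p.1.1.1 (Sum.elim p.1.2.1 (T.act p.1.1 p.1.2 p.2).1) : κ ⊕ (κ' ⊕ κ') → F)))
    (hT : ∀ q, T.proj q = π (T.anchor q)) : X.EliminableOver K := by
  let _ := Ring.compatibleRingOfRing F
  obtain ⟨l, ⟨σ⟩⟩ := Finite.exists_equiv_fin ι'
  obtain ⟨m, ⟨τ⟩⟩ := Finite.exists_equiv_fin κ'
  let a := (τ.arrowCongr (Equiv.refl F)).image P
  let b := (σ.arrowCongr (Equiv.refl F)).image Y
  refine ⟨l, m, σ.arrowCongr (Equiv.refl F) '' Y, b ∘ π, τ.arrowCongr (Equiv.refl F) '' P,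
    T.transport a b, hY.image_comp_equiv σ.symm, ?_,
    ⟨b.surjective.comp hπX.1, fun x y => by simp [hπX.2]⟩, hP.image_comp_equiv τ.symm, ?_, ?_, ?_, ?_⟩
  · have := Set.Definable.image_comp_equiv hπ ((Equiv.refl ι).sumCongr σ.symm)
    rw [← Set.range_comp] at this
    change K.Definable Language.ring _
    convert this using 2
    ext x i
    rcases i with i | i <;> rfl
  · have := Set.Definable.image_comp_equiv hproj (τ.symm.sumCongr σ.symm)
    rw [← Set.range_comp] at this
    change K.Definable Language.ring _
    rw [← a.surjective.range_comp]
    convert this using 2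
    ext x i
    rcases i with i | i <;> simp [Torsor.transport, a, b]
  · have := Set.Definable.image_comp_equiv hanchor (τ.symm.sumCongr (Equiv.refl ι))
    rw [← Set.range_comp] at this
    change K.Definable Language.ring _
    rw [← a.surjective.range_comp]
    convert this using 2
    ext x i
    rcases i with i | i <;> simp [Torsor.transport, a]
  · have := Set.Definable.image_comp_equiv hact
      ((Equiv.refl κ).sumCongr (τ.symm.sumCongr τ.symm))
    rw [← Set.range_comp] at this
    change K.Definable Language.ring _
    let E : {p : X₁ × P // X.src p.1 = T.anchor p.2} →
        {p : X₁ × (τ.arrowCongr (Equiv.refl F) '' P : Set _) //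
          X.src p.1 = (T.transport a b).anchor p.2} :=
      fun p => ⟨(p.1.1, a p.1.2), by simpa [Torsor.transport] using p.2⟩
    have hE : Function.Surjective E := fun ⟨⟨x, y⟩, h⟩ => ⟨⟨(x, a.symm y), h⟩, by simp [E]⟩
    rw [← hE.range_comp]
    convert this using 2
    ext x i
    rcases i with i | i | i <;> simp [Torsor.transport, E, a]
  · intro q
    simp [Torsor.transport, hT]

/-- The quotient is the fixed-point set of `ρ`, and the torsor consists of the arrows whose source
is fixed by `ρ`. -/
theorem DefinableOver.eliminableOver [Finite ι] [Finite κ] (hX : X.DefinableOver K) {ρ : X₀ → X₀}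
    (hdef : IsDefinableMap K ρ) (hρ : ∀ x, Nonempty (X.Mor x (ρ x)))
    (hρ' : ∀ x y, Nonempty (X.Mor x y) → ρ x = ρ y) : X.EliminableOver K := by
  let _ := Ring.compatibleRingOfRing F
  let Y₀ : Set X₀ := {x | ρ x = x}
  let P₀ : Set X₁ := {m | ρ (X.src m) = X.src m}
  let a := Equiv.Set.image ((↑) : X₁ → κ → F) P₀ Subtype.val_injective
  let b := Equiv.Set.image ((↑) : X₀ → ι → F) Y₀ Subtype.val_injective
  let T := (X.representativeTorsor ρ).transport a b
  have ha : ∀ q, (a q : κ → F) = q.1.1 := fun _ => rfl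
  have hb : ∀ y, (b y : ι → F) = y.1.1 := fun _ => rfl
  have hρρ : ∀ x, ρ (ρ x) = ρ x := fun x => (hρ' _ _ (hρ x)).symm
  have hY : IsDefinable K ((↑) '' Y₀ : Set (ι → F)) := by
    -- The fixed points are the preimage of the graph of `ρ` under the diagonal.
    have := Set.Definable.preimage_comp (Sum.elim id id : ι ⊕ ι → ι)
      (show K.Definable Language.ring _ from hdef)
    change K.Definable Language.ring _
    convert this using 1
    ext x
    constructor
    · rintro ⟨x, hx, rfl⟩
      refine ⟨x, ?_⟩
      ext (i | i)
      · rfl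
      · exact congrFun (congrArg Subtype.val hx) i
    · rintro ⟨y, hy⟩
      have h₁ : y.1 = x := funext fun i => congrFun hy (Sum.inl i)
      have h₂ : (ρ y).1 = x := funext fun i => congrFun hy (Sum.inr i)
      exact ⟨y, Subtype.ext (h₂.trans h₁.symm), h₁⟩
  have hP : IsDefinable K ((↑) '' P₀ : Set (κ → F)) := by
    have := Set.Definable.exists_of_finite
      (Set.Definable.inter hX.src (Set.Definable.preimage_comp (Sum.inr : ι → κ ⊕ ι) hY))
    change K.Definable Language.ring _
    convert this using 1
    ext m
    constructor
    · rintro ⟨m, hm, rfl⟩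
      exact ⟨X.src m, ⟨m, rfl⟩, X.src m, hm, rfl⟩
    · rintro ⟨w, ⟨m', hm'⟩, y, hy, hyw⟩
      have h₁ : m'.1 = m := funext fun i => congrFun hm' (Sum.inl i)
      have h₂ : X.src m' = y :=
        Subtype.ext ((funext fun i => congrFun hm' (Sum.inr i) : (X.src m').1 = w).trans hyw.symm)
      exact ⟨m', by rw [← h₂] at hy; exact hy, h₁⟩
  have hrestrict : ∀ f : X₁ → X₀, IsDefinableMap K f →
      IsDefinable K (Set.range fun q : P₀ => (Sum.elim q.1.1 (f q.1).1 : κ ⊕ ι → F)) := by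
    intro f hf
    have := Set.Definable.inter hf (Set.Definable.preimage_comp (Sum.inl : κ → κ ⊕ ι) hP)
    change K.Definable Language.ring _
    convert this using 1
    ext u
    constructor
    · rintro ⟨q, rfl⟩
      exact ⟨⟨q.1, rfl⟩, q.1, q.2, rfl⟩
    · rintro ⟨⟨m, rfl⟩, m', hm', h⟩
      obtain rfl : m' = m := Subtype.ext h
      exact ⟨⟨m', hm'⟩, rfl⟩
  refine eliminableOver_of_torsor (π := fun x => b ⟨ρ x, hρρ x⟩) T hY hdef ⟨?_, ?_⟩ hP ?_ ?_ ?_ ?_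
  · intro y
    obtain ⟨⟨x, hx⟩, rfl⟩ := b.surjective y
    exact ⟨x, congrArg b (Subtype.ext hx)⟩
  · intro x y
    rw [b.injective.eq_iff, Subtype.mk.injEq]
    refine ⟨fun h => ?_, hρ' x y⟩
    obtain ⟨f, hf, hf'⟩ := hρ x
    obtain ⟨g, hg, hg'⟩ := hρ y
    exact ⟨X.comp (X.inv g) f (by rw [X.src_inv, hg', hf', h]), by rw [X.src_comp, hf],
      by rw [X.tgt_comp, X.tgt_inv, hg]⟩
  · unfold IsDefinableMap
    rw [← a.surjective.range_comp]
    convert hrestrict X.src hX.src using 2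
    ext q
    simp [T, Torsor.transport, representativeTorsor, ha, hb]
  · unfold IsDefinableMap
    rw [← a.surjective.range_comp]
    convert hrestrict X.tgt hX.tgt using 2
    ext q
    simp [T, Torsor.transport, representativeTorsor, ha]
  · have := Set.Definable.inter hX.comp
      (Set.Definable.preimage_comp (Sum.inr ∘ Sum.inl : κ → κ ⊕ (κ ⊕ κ)) hP)
    change K.Definable Language.ring _
    convert this using 1
    ext u
    constructor
    · rintro ⟨⟨⟨m, q⟩, h⟩, rfl⟩
      obtain ⟨q, rfl⟩ := a.surjective q
      refine ⟨⟨⟨(m, q.1), by simpa [T, Torsor.transport, representativeTorsor] using h⟩, ?_⟩,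
        q.1, q.2, rfl⟩
      simp [T, Torsor.transport, representativeTorsor, ha]
    · rintro ⟨⟨⟨⟨m, q⟩, h⟩, rfl⟩, q', hq', hqq⟩
      obtain rfl : q' = q := Subtype.ext hqq
      refine ⟨⟨(m, a ⟨q', hq'⟩), by simpa [T, Torsor.transport, representativeTorsor] using h⟩, ?_⟩
      simp [T, Torsor.transport, representativeTorsor, ha]
  · intro q
    obtain ⟨q, rfl⟩ := a.surjective q
    -- The arrow `q` joins its source to its target, so `ρ` agrees on both, and it fixes the source.
    have : ρ (X.tgt q.1) = X.src q.1 := (hρ' _ _ ⟨X.inv q.1, X.src_inv _, X.tgt_inv _⟩).trans q.2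
    simp [T, Torsor.transport, representativeTorsor, this]

end Eliminable
end Gpd

/-! ### Definable representatives of isomorphism classes -/

namespace Gpd

section Representatives

variable {k : Type*} {n : ℕ} {κ : Type*} {X₀ : Set (Fin n → k)} {X₁ : Set (κ → k)} {X : Gpd X₀ X₁}

/-- The points of the isomorphism class of `x`. -/
def isoClass (X : Gpd X₀ X₁) (x : Fin n → k) : Set (Fin n → k) :=
  {y | ∃ m : X₁, (X.src m).1 = x ∧ (X.tgt m).1 = y}

/-- Since `pick` depends only on the set, isomorphic objects get the same representative. -/
theorem isoClass_eq {x y : X₀} (h : Nonempty (X.Mor x y)) :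
    X.isoClass x = X.isoClass y := by
  obtain ⟨f, rfl, rfl⟩ := h
  ext z
  constructor
  · rintro ⟨m, hm, rfl⟩
    exact ⟨X.comp m (X.inv f) ((Subtype.ext hm).trans (X.tgt_inv f).symm),
      by rw [X.src_comp, X.src_inv], by rw [X.tgt_comp]⟩
  · rintro ⟨m, hm, rfl⟩
    exact ⟨X.comp m f (Subtype.ext hm), by rw [X.src_comp], by rw [X.tgt_comp]⟩

variable {R : Type*} [Field R] [Field k] {e : k ≃+* Cplx R} {K : Set k} [Finite κ]

theorem DefinableOver.isDefinable_isoClass (hX : X.DefinableOver K) :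
    IsDefinable K {u : Fin n ⊕ Fin n → k | u ∘ Sum.inr ∈ X.isoClass (u ∘ Sum.inl)} := by
  let _ := Ring.compatibleRingOfRing k
  have := Set.Definable.exists_of_finite (Set.Definable.inter
    (Set.Definable.preimage_comp (Sum.elim Sum.inr (Sum.inl ∘ Sum.inl) :
      κ ⊕ Fin n → (Fin n ⊕ Fin n) ⊕ κ) hX.src)
    (Set.Definable.preimage_comp (Sum.elim Sum.inr (Sum.inl ∘ Sum.inr) :
      κ ⊕ Fin n → (Fin n ⊕ Fin n) ⊕ κ) hX.tgt))
  change K.Definable Language.ring _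
  convert this using 1
  ext u
  constructor
  · rintro ⟨m, h, h'⟩
    refine ⟨m.1, ⟨m, ?_⟩, m, ?_⟩
    · ext (i | i)
      exacts [rfl, congrFun h i]
    · ext (i | i)
      exacts [rfl, congrFun h' i]
  · rintro ⟨w, ⟨m, hm⟩, m', hm'⟩
    have h : m.1 = w := funext fun i => congrFun hm (Sum.inl i)
    have h' : m'.1 = w := funext fun i => congrFun hm' (Sum.inl i)
    obtain rfl : m = m' := Subtype.ext (h.trans h'.symm)
    exact ⟨m, funext fun i => congrFun hm (Sum.inr i), funext fun i => congrFun hm' (Sum.inr i)⟩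

variable [IsRealClosed R] [IsAlgClosed k]

theorem DefinableOver.pick_mem_isoClass (hX : X.DefinableOver K) (x : X₀) :
    pick e n (X.isoClass x) ∈ X.isoClass x := by
  let _ := Ring.compatibleRingOfRing k
  refine pick_mem (K := Set.univ) (Set.Definable.preimage_map
    (F := fun y : Fin n → k => (Sum.elim x.1 y : Fin n ⊕ Fin n → k)) ?_
    (Set.Definable.mono hX.isDefinable_isoClass (Set.subset_univ K)))
    ⟨x, X.one x, by rw [X.src_one], by rw [X.tgt_one]⟩
  rintro (i | i)
  · exact Language.definableFun_const _ _ (Set.mem_univ _)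
  · exact Set.DefinableFun.proj _

/-- The representative is `pick` of the class. Its graph is definable in `R` and in general not in
`k`: nothing in the field `k` alone distinguishes the two square roots of `-1`, but the order does.
-/
theorem DefinableOver.exists_representatives (hX : X.DefinableOver K) :
    ∃ ρ : X₀ → X₀, (∀ x, Nonempty (X.Mor x (ρ x))) ∧
      (∀ x y, Nonempty (X.Mor x y) → ρ x = ρ y) ∧
      RealDefinable e (realParams e K)
        (· ∈ Set.range fun x => (Sum.elim x.1 (ρ x).1 : Fin n ⊕ Fin n → k)) := by
  have hpick := hX.pick_mem_isoClass (e := e)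
  have hmem : ∀ x : X₀, pick e n (X.isoClass x) ∈ X₀ := fun x => by
    obtain ⟨m, -, hm⟩ := hpick x
    exact hm ▸ (X.tgt m).2
  refine ⟨fun x => ⟨_, hmem x⟩, fun x => ?_, fun x y h => Subtype.ext ?_, ?_⟩
  · obtain ⟨m, hm, hm'⟩ := hpick x
    exact ⟨m, Subtype.ext hm, Subtype.ext hm'⟩
  · simp only [isoClass_eq h]
  · have := (hX.obj.realDefinable (e := e).comp (Sum.inl : Fin n → Fin n ⊕ Fin n)).and
      (RealDefinable.eq_pick (p := fun x y => y ∈ X.isoClass x) hX.isDefinable_isoClass.realDefinable)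
    convert this using 2 with u
    constructor
    · rintro ⟨x, rfl⟩
      exact ⟨x.2, rfl⟩
    · rintro ⟨h, h'⟩
      refine ⟨⟨_, h⟩, ?_⟩
      ext (i | i)
      exacts [rfl, (congrFun h' i).symm]

theorem DefinableOver.toReal_eliminableOver (hX : X.DefinableOver K) :
    (X.toReal e).EliminableOver (realParams e K) := by
  obtain ⟨ρ, hρ, hρ', hdef⟩ := hX.exists_representatives (e := e)
  let a := (realCoords e (Fin n)).image X₀
  have hMor : ∀ x y, Nonempty ((X.toReal e).Mor (a x) (a y)) ↔ Nonempty (X.Mor x y) := by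
    intro x y
    constructor
    · rintro ⟨f, hf, hf'⟩
      exact ⟨_, a.injective hf, a.injective hf'⟩
    · rintro ⟨f, hf, hf'⟩
      exact ⟨(realCoords e κ).image X₁ f, by simp [Gpd.toReal, Gpd.transport, hf, a],
        by simp [Gpd.toReal, Gpd.transport, hf', a]⟩
  refine hX.toReal.eliminableOver hdef.isDefinableMap (fun x => ?_) fun x y => ?_
  · obtain ⟨x, rfl⟩ := a.surjective x
    simpa [a] using (hMor x (ρ x)).2 (hρ x)
  · obtain ⟨x, rfl⟩ := a.surjective x
    obtain ⟨y, rfl⟩ := a.surjective y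
    rw [hMor]
    intro h
    simp [a, hρ' x y h]

end Representatives

end Gpd
end ElimGroupoid

/-- Since `R` admits canonical choices from the sets definable in `k`, the isomorphism classes of `X`
have definable representatives over `K`, whatever the automorphism groups are: the hypotheses on `A`
are not needed. -/
theorem mainTheorem6 {R : Type*} {k : Type*} [Field R] [IsRealClosed R] [Field k] [IsAlgClosed k]
    (e : k ≃+* Cplx R) (K : Set k)
    {n₀ n₁ d : ℕ} {X₀ : Set (Fin n₀ → k)} {X₁ : Set (Fin n₁ → k)} (X : Gpd X₀ X₁)
    (A : Set (Fin d → k)) [CommGroup A]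
    (hX : X.DefinableOver K) (hA : IsDefinableGroup K A) (hXA : X.BoundedBy K A) :
    (X.toReal e).DefinableOver (realParams e K) ∧
      (X.toReal e).EliminableOver (realParams e K) :=
  ⟨hX.toReal, hX.toReal_eliminableOver⟩
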